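/- Let $T_u,T_u'\ge 1$, $T_p\ge 0$ and $\hat\delta\ge1$ be integers and let $C_p,C_u,\omega\ge 0$ be real. A device chooses at each decision epoch an action $a\in\mathcal A=\{(0,0),(0,1),(1,1)\}$ (idle; transmit a fresh update directly; preprocess a fresh update and transmit it). The action lasts $L(a)$ minislots and uses energy $C(a)$, where $$L(0,0)=1,\quad L(0,1)=T_u,\quad L(1,1)=T_p+T_u',\qquad C(0,0)=0,\quad C(0,1)=T_uC_u,\quad C(1,1)=T_pC_p+T_u'C_u.$$ The state $s\in\mathcal S=\{1,\dots,\hat\delta\}$ is the age of information. The channel is reliable ($p_s=1$), so from $s$ the next state is $\min(s+1,\hat\delta)$ under $(0,0)$ and $\min(L(a),\hat\delta)$ under $a\ne(0,0)$; write $p(s'\mid s,a)$ for the resulting transition probability. A time step in state $s$ with action $a$ costs $R(s,a)=\sum_{i=1}^{L(a)}(s+i-1)+\omega C(a)$. The problem is to minimize, over stationary deterministic policies $\pi:\mathcal S\to\mathcal A$, the average cost $$\limsup_{T\to\infty}\frac{\mathbb E\big[\sum_{t=1}^T R(s(t),\pi(s(t)))\mid s(1)\big]}{\mathbb E\big[\sum_{t=1}^T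 L(\pi(s(t)))\mid s(1)\big]}.$$ For $0<\epsilon\le\min_a L(a)$ put $\bar R(s,a)=R(s,a)/L(a)$, $\bar p(s'\mid s,a)=\frac{\epsilon}{L(a)}p(s'\mid s,a)$ for $s'\ne s$, and $\bar p(s\mid s,a)=1-\frac{\epsilon}{L(a)}\big(1-p(s\mid s,a)\big)$. The Bellman equation is $$\theta+V(s)=\min_{a\in\mathcal A}Q(s,a),\qquad Q(s,a)=\bar R(s,a)+\sum_{s'\in\mathcal S}\bar p(s'\mid s,a)V(s'),\qquad s\in\mathcal S,$$ and a policy $\pi$ is called Bellman-optimal for $V$ if $\pi(s)\in\arg\min_a Q(s,a)$ for all $s\in\mathcal S$. Let $a_f=(0,1)$ if $T_u\le T_p+T_u'$ and $a_f=(1,1)$ if $T_u\ge T_p+T_u'$ (either choice in case of equality), and let $\mathcal S^\dagger=\{s\in\mathcal S: s\ge\min\{T_u,T_p+T_u'\}\}$. Call a policy $\pi$ of switch type if $\pi(s)\ne(0,0)$ for all $s\in\mathcal S^\dagger$ and * if $T_u\le T_p+T_u'$, there is an integer $\Omega\ge\min\{T_u,T_p+T_u'\}$ such that for $s\in\mathcal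 S^\dagger$, $\pi(s)=(1,1)$ when $s<\Omega$ and $\pi(s)=(0,1)$ when $s\ge\Omega$; * if $T_u\ge T_p+T_u'$, there is an integer $\Omega\ge\min\{T_u,T_p+T_u'\}$ such that for $s\in\mathcal S^\dagger$, $\pi(s)=(0,1)$ when $s<\Omega$ and $\pi(s)=(1,1)$ when $s\ge\Omega$. **Theorem.** Suppose $\frac12L(a_f)(L(a_f)+1)\ge\omega C(a_f)$ and that the age limit is large enough, namely $\hat\delta>2L(a_f)$. Then the Bellman equation has a solution $(\theta,V)$, and for every solution $(\theta,V)$ the following hold. 1. There is a Bellman-optimal policy $\pi^*$ for $V$ that is of switch type. It is moreover unichain and minimizes the average cost over all stationary deterministic policies from every initial state. 2. If $\frac12L(a_f)(L(a_f)+1)>\omega C(a_f)$ and $T_u\ne T_p+T_u'$, then every Bellman-optimal policy for $V$ is of switch type. -/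

import Mathlib

open scoped BigOperators

noncomputable section

namespace StatusUpdate

/-- The three feasible actions `(a_p, a_u)`. -/
inductive Action where
  /-- `(0,0)`: stay idle for one minislot. -/
  | idle
  /-- `(0,1)`: sample and transmit directly. -/
  | direct
  /-- `(1,1)`: sample, preprocess, then transmit. -/
  | preprocess

/-- Parameters of the status updating system. Durations are counted in minislots. -/
structure Model where
  /-- Number `T_u` of packets of a status update before preprocessing. -/
  Tu : ℕ
  /-- Number `T_u'` of packets of a status update after preprocessing. -/
  TuPre : ℕ
  /-- Number `T_p` of minislots needed for preprocessing. -/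
  Tp : ℕ
  /-- Computation energy `C_p` per minislot. -/
  Cp : ℝ
  /-- Communication energy `C_u` per minislot. -/
  Cu : ℝ
  /-- Weighting factor `ω`. -/
  omega : ℝ
  /-- Success probability `p_s` of a packet. -/
  ps : ℝ
  /-- Upper limit of the age of information. -/
  ageMax : ℕ
  Tu_pos : 0 < Tu
  TuPre_pos : 0 < TuPre
  Cp_nonneg : 0 ≤ Cp
  Cu_nonneg : 0 ≤ Cu
  omega_nonneg : 0 ≤ omega
  ps_pos : 0 < ps
  ps_le_one : ps ≤ 1
  ageMax_pos : 0 < ageMax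

namespace Model

variable (M : Model)

/-- Duration `L(a)` of a time step with action `a`, in minislots. -/
def L : Action → ℕ
  | .idle => 1
  | .direct => M.Tu
  | .preprocess => M.Tp + M.TuPre

/-- Transmission time `L_u(a)`. -/
def Lu : Action → ℕ
  | .idle => 0
  | .direct => M.Tu
  | .preprocess => M.TuPre

/-- Energy `C(a)` consumed by action `a`. -/
def C : Action → ℝ
  | .idle => 0
  | .direct => M.Tu * M.Cu
  | .preprocess => M.Tp * M.Cp + M.TuPre * M.Cu

/-- The state space `{1, …, ageMax}`: age of information at the start of a time step. -/
abbrev State : Type := Finset.Icc 1 M.ageMax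

/-- Stationary deterministic policies. -/
abbrev Policy : Type := M.State → Action

/-- Transition probability `p (t | s, a)` of the semi-Markov decision process. -/
def trans (s : M.State) (a : Action) (t : M.State) : ℝ :=
  match a with
  | .idle => if (t : ℕ) = min ((s : ℕ) + 1) M.ageMax then 1 else 0
  | a =>
    (if (t : ℕ) = min (M.L a) M.ageMax then M.ps ^ M.Lu a else 0) +
      (if (t : ℕ) = min ((s : ℕ) + M.L a) M.ageMax then 1 - M.ps ^ M.Lu a else 0)

/-- Cost `R(s, a)` of a time step: total age over its minislots plus weighted energy. -/
def cost (s : M.State) (a : Action) : ℝ :=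
  ∑ i ∈ Finset.range (M.L a), (((s : ℕ) : ℝ) + (i : ℝ)) + M.omega * M.C a

/-! ### The average cost criterion of the semi-Markov decision process -/

/-- Transition matrix of the Markov chain induced by a policy. -/
def transMatrix (π : M.Policy) : Matrix M.State M.State ℝ :=
  Matrix.of fun s t => M.trans s (π s) t

/-- Expected value of `f` at the state reached after `n` time steps from `s` under `π`. -/
def expectAt (π : M.Policy) (f : M.State → ℝ) (n : ℕ) (s : M.State) : ℝ :=
  ((M.transMatrix π ^ n).mulVec f) s

/-- Long-run average cost of `π` from the initial state `s`: the limit superior of the expected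
total cost of the first `T` time steps divided by their expected total duration. (The quotients
are bounded, since there are finitely many states and every duration is at least one.) -/
def avgCost (π : M.Policy) (s : M.State) : ℝ :=
  Filter.limsup
    (fun T : ℕ =>
      (∑ n ∈ Finset.range T, M.expectAt π (fun x => M.cost x (π x)) n s) /
        (∑ n ∈ Finset.range T, M.expectAt π (fun x => (M.L (π x) : ℝ)) n s))
    Filter.atTop

/-- `π` minimizes the average cost over all stationary deterministic policies, from every
initial state. -/
def IsAverageOptimal (π : M.Policy) : Prop :=
  ∀ (ρ : M.Policy) (s : M.State), M.avgCost π s ≤ M.avgCost ρ s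

/-- State `t` is accessible from state `s` under `π`. -/
def Accessible (π : M.Policy) : M.State → M.State → Prop :=
  Relation.ReflTransGen fun s t => 0 < M.trans s (π s) t

/-- Recurrent states of the (finite) chain induced by `π`. -/
def IsRecurrent (π : M.Policy) (s : M.State) : Prop :=
  ∀ t, M.Accessible π s t → M.Accessible π t s

/-- `π` is unichain: the recurrent states form a single class. -/
def IsUnichain (π : M.Policy) : Prop :=
  ∀ s t, M.IsRecurrent π s → M.IsRecurrent π t → M.Accessible π s t

/-! ### The equivalent uniform time step decision process -/

/-- Cost per minislot `R(s, a) / L(a)`. -/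
def costBar (s : M.State) (a : Action) : ℝ :=
  M.cost s a / M.L a

/-- Transition probability of the uniformized process with parameter `ε`: with probability
`ε / L(a)` a transition of the original process (possibly from `s` to `s`) takes place, otherwise
the state is kept. -/
def transBar (ε : ℝ) (s : M.State) (a : Action) (t : M.State) : ℝ :=
  if t = s then 1 - ε / M.L a * (1 - M.trans s a s) else ε / M.L a * M.trans s a t

/-- State-action value function `Q(s, a)` belonging to `V`. -/
def Q (ε : ℝ) (V : M.State → ℝ) (s : M.State) (a : Action) : ℝ :=
  M.costBar s a + ∑ t, M.transBar ε s a t * V t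

/-- The Bellman equation `θ + V(s) = min_a Q(s, a)` for all states `s`. -/
def Bellman (ε θ : ℝ) (V : M.State → ℝ) : Prop :=
  ∀ s, IsLeast (Set.range (M.Q ε V s)) (θ + V s)

/-- `π(s)` is a minimizer of `Q(s, ·)` for every state `s`. -/
def IsBellmanOptimal (ε : ℝ) (V : M.State → ℝ) (π : M.Policy) : Prop :=
  ∀ s a, M.Q ε V s (π s) ≤ M.Q ε V s a

/-! ### The structure of the policy -/

/-- `a` is an admissible choice of `a_f`, the updating action with the smaller expected time to
a successful transmission (both are admissible in the case of equality). -/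
def IsFastAction : Action → Prop
  | .idle => False
  | .direct => (M.Tu : ℝ) / M.ps ^ M.Tu ≤ ((M.Tp : ℝ) + M.TuPre) / M.ps ^ M.TuPre
  | .preprocess => ((M.Tp : ℝ) + M.TuPre) / M.ps ^ M.TuPre ≤ (M.Tu : ℝ) / M.ps ^ M.Tu

/-- The smallest state `min {T_u, T_p + T_u'}` of the reduced state space. -/
def ageMin : ℕ := min M.Tu (M.Tp + M.TuPre)

/-- On the states `s ≥ ageMin`, the policy takes action `lo` below the threshold `Ω` and action
`hi` from the threshold on. -/
def IsThreshold (π : M.Policy) (lo hi : Action) (Ω : ℕ) : Prop :=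
  ∀ s : M.State, M.ageMin ≤ s →
    ((s : ℕ) < Ω → π s = lo) ∧ (Ω ≤ (s : ℕ) → π s = hi)

/-- On the states `s ≥ ageMin`, the policy never idles and is of switch type. -/
def IsSwitchType (π : M.Policy) : Prop :=
  (∀ s : M.State, M.ageMin ≤ s → π s ≠ .idle) ∧
  (M.Tu ≤ M.Tp + M.TuPre → ∃ Ω, M.ageMin ≤ Ω ∧ M.IsThreshold π .preprocess .direct Ω) ∧
  (M.Tp + M.TuPre ≤ M.Tu → ∃ Ω, M.ageMin ≤ Ω ∧ M.IsThreshold π .direct .preprocess Ω)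

end Model

end StatusUpdate

end

/-! Over a reliable channel every transition is deterministic. By `Q_eq` the Bellman equation then
says that the residuals R(s,a) - θL(a) + εV(s') - εV(s) are nonnegative, with a zero in each state;
the Bellman-optimal policies are those that select zeros. Summed along an orbit the V terms
telescope, so θ is a lower bound for every average cost and is attained by such policies.

Write d for the length of the fast action. Repeating it from age d forms a cycle, and the energy
hypothesis turns the cost of this cycle into θ ≤ 2d. An update erases the current age, so postponing
it from s ≥ d to s + 1 costs s + L(a) ≥ 2d and saves only θ. Idling is therefore never needed at
such ages (`residual_update_le`), and at the age cap it is excluded by 2d < `ageMax`. Between the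
two updates, the residual difference is affine in the age with slope of constant sign
(`residual_sub`), which gives the switch.

For existence, V on ages ≥ d is determined by its values at the two ages where updates land
(`exists_cycle_solution`); lower ages are filled in by backward recursion. -/

namespace StatusUpdate

namespace Model

variable (M : Model)

/-! ### Deterministic dynamics over a reliable channel -/

/-- The successor state when the channel is reliable. -/
def next (s : M.State) (a : Action) : M.State :=
  match a with
  | .idle => ⟨min ((s : ℕ) + 1) M.ageMax,
      Finset.mem_Icc.2 ⟨le_min (Nat.le_add_left 1 _) M.ageMax_pos, min_le_right _ _⟩⟩
  | .direct => ⟨min (M.L .direct) M.ageMax,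
      Finset.mem_Icc.2 ⟨le_min M.Tu_pos M.ageMax_pos, min_le_right _ _⟩⟩
  | .preprocess => ⟨min (M.L .preprocess) M.ageMax,
      Finset.mem_Icc.2 ⟨le_min (Nat.add_pos_right _ M.TuPre_pos) M.ageMax_pos, min_le_right _ _⟩⟩

variable {M}

theorem L_pos (a : Action) : 0 < M.L a := by
  have h1 := M.Tu_pos
  have h2 := M.TuPre_pos
  cases a <;> simp only [L] <;> omega

theorem L_pos_real (a : Action) : (0 : ℝ) < M.L a := Nat.cast_pos.2 (L_pos a)

theorem state_le (s : M.State) : (s : ℕ) ≤ M.ageMax := (Finset.mem_Icc.1 s.2).2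

theorem next_idle (s : M.State) : (M.next s .idle : ℕ) = min ((s : ℕ) + 1) M.ageMax := rfl

theorem next_update (s : M.State) {a : Action} (ha : a ≠ .idle) :
    (M.next s a : ℕ) = min (M.L a) M.ageMax := by
  cases a
  · exact absurd rfl ha
  · rfl
  · rfl

theorem next_update_eq (s t : M.State) {a : Action} (ha : a ≠ .idle) :
    M.next s a = M.next t a :=
  Subtype.ext ((next_update s ha).trans (next_update t ha).symm)

theorem trans_eq (hps : M.ps = 1) (s : M.State) (a : Action) (t : M.State) :
    M.trans s a t = if t = M.next s a then 1 else 0 := by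
  cases a <;> simp [trans, next, hps, Subtype.ext_iff]

theorem cost_idle (s : M.State) : M.cost s .idle = (s : ℕ) := by
  simp [cost, L, C]

theorem cost_update_sub (s t : M.State) (a : Action) :
    M.cost t a - M.cost s a = M.L a * (((t : ℕ) : ℝ) - ((s : ℕ) : ℝ)) := by
  simp only [cost, Finset.sum_add_distrib, Finset.sum_const, Finset.card_range, nsmul_eq_mul]
  ring

theorem sum_range_cast (n : ℕ) : ∑ i ∈ Finset.range n, (i : ℝ) = n * (n - 1) / 2 := by
  induction n with
  | zero => simp
  | succ k ih => rw [Finset.sum_range_succ, ih]; push_cast; ring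

theorem cost_eq (s : M.State) (a : Action) :
    M.cost s a = M.L a * ((s : ℕ) : ℝ) + ((M.L a : ℝ) * (M.L a - 1) / 2 + M.omega * M.C a) := by
  simp only [cost, Finset.sum_add_distrib, Finset.sum_const, Finset.card_range, nsmul_eq_mul,
    sum_range_cast]
  ring

/-! ### The Bellman equation in terms of residuals -/

variable (M) in
/-- Residual of action `a` in state `s` in the Bellman equation of the semi-Markov process. -/
def residual (ε θ : ℝ) (V : M.State → ℝ) (s : M.State) (a : Action) : ℝ :=
  M.cost s a - θ * M.L a + ε * V (M.next s a) - ε * V s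

/-- `transBar` is the mixture of staying at s, with weight 1 - ε/L(a), and moving to the successor,
with weight ε/L(a); this remains true when the successor is s itself. -/
theorem Q_eq (hps : M.ps = 1) (ε θ : ℝ) (V : M.State → ℝ) (s : M.State) (a : Action) :
    M.Q ε V s a = θ + V s + M.residual ε θ V s a / M.L a := by
  have hL : (M.L a : ℝ) ≠ 0 := (L_pos_real a).ne'
  have hT : ∀ t, M.transBar ε s a t * V t =
      (if t = s then (1 - ε / M.L a) * V t else 0) +
        (if t = M.next s a then ε / M.L a * V t else 0) := by
    intro t
    simp only [transBar, trans_eq hps]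
    by_cases h : t = s
    · subst h
      by_cases h' : t = M.next t a
      · rw [if_pos rfl, if_pos rfl, if_pos h', if_pos h']; ring
      · rw [if_pos rfl, if_pos rfl, if_neg h', if_neg h']; ring
    · rw [if_neg h, if_neg h]
      split_ifs <;> ring
  rw [Q, Finset.sum_congr rfl fun t _ => hT t, Finset.sum_add_distrib, Finset.sum_ite_eq',
    Finset.sum_ite_eq', if_pos (Finset.mem_univ _), if_pos (Finset.mem_univ _), costBar, residual]
  field_simp
  ring

theorem bellman_iff (hps : M.ps = 1) {ε θ : ℝ} {V : M.State → ℝ} :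
    M.Bellman ε θ V ↔ ∀ s, (∀ a, 0 ≤ M.residual ε θ V s a) ∧ ∃ a, M.residual ε θ V s a = 0 := by
  refine forall_congr' fun s => ?_
  constructor
  · rintro ⟨⟨a, ha⟩, hlb⟩
    refine ⟨fun b => ?_, a, ?_⟩
    · have h := hlb ⟨b, rfl⟩
      rw [Q_eq hps ε θ, le_add_iff_nonneg_right] at h
      by_contra hneg
      exact absurd h (not_le.2 (div_neg_of_neg_of_pos (not_le.1 hneg) (L_pos_real b)))
    · rw [Q_eq hps ε θ, add_eq_left, div_eq_zero_iff] at ha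
      exact ha.resolve_right (L_pos_real a).ne'
  · rintro ⟨hnn, a, ha⟩
    refine ⟨⟨a, ?_⟩, ?_⟩
    · rw [Q_eq hps ε θ, ha, zero_div, add_zero]
    · rintro _ ⟨b, rfl⟩
      rw [Q_eq hps ε θ]
      exact le_add_of_nonneg_right (div_nonneg (hnn b) (L_pos_real b).le)

theorem isBellmanOptimal_iff (hps : M.ps = 1) {ε θ : ℝ} {V : M.State → ℝ}
    (hB : M.Bellman ε θ V) {π : M.Policy} :
    M.IsBellmanOptimal ε V π ↔ ∀ s, M.residual ε θ V s (π s) = 0 := by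
  refine forall_congr' fun s => ?_
  obtain ⟨hnn, a, ha⟩ := (bellman_iff hps).1 hB s
  simp only [Q_eq hps ε θ V, add_le_add_iff_left]
  constructor
  · intro h
    have h1 := h a
    rw [ha, zero_div] at h1
    have h2 := div_nonneg (hnn (π s)) (L_pos_real (M := M) (π s)).le
    have h3 := le_antisymm h1 h2
    exact (div_eq_zero_iff.1 h3).resolve_right (L_pos_real (π s)).ne'
  · intro h b
    rw [h, zero_div]
    exact div_nonneg (hnn b) (L_pos_real b).le

theorem residual_idle (ε θ : ℝ) (V : M.State → ℝ) (s : M.State) :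
    M.residual ε θ V s .idle = (s : ℕ) - θ + ε * V (M.next s .idle) - ε * V s := by
  simp [residual, cost_idle, L]

/-- The state after an update does not depend on the state before it, so only the age cost differs,
by one unit per minislot and unit of age. -/
theorem residual_update_sub (ε θ : ℝ) (V : M.State → ℝ) (s t : M.State) {a : Action}
    (ha : a ≠ .idle) :
    M.residual ε θ V t a + ε * V t =
      M.residual ε θ V s a + ε * V s + M.L a * (((t : ℕ) : ℝ) - ((s : ℕ) : ℝ)) := by
  rw [← cost_update_sub, residual, residual, next_update_eq t s ha]
  ring

/-! ### Average cost -/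

theorem expectAt_eq (hps : M.ps = 1) (π : M.Policy) (f : M.State → ℝ) (n : ℕ) (s : M.State) :
    M.expectAt π f n s = f ((fun x => M.next x (π x))^[n] s) := by
  induction n generalizing s with
  | zero => simp [expectAt]
  | succ n ih =>
    have hstep : ∀ g : M.State → ℝ, (M.transMatrix π).mulVec g s = g (M.next s (π s)) := by
      intro g
      simp [Matrix.mulVec, dotProduct, transMatrix, trans_eq hps]
    rw [Function.iterate_succ_apply, ← ih, expectAt, pow_succ', ← Matrix.mulVec_mulVec, hstep]
    rfl

theorem exists_forall_abs_le (f : M.State → ℝ) : ∃ K : ℝ, 0 ≤ K ∧ ∀ s, |f s| ≤ K :=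
  ⟨∑ s, |f s|, Finset.sum_nonneg fun _ _ => abs_nonneg _,
    fun s => Finset.single_le_sum (f := fun s => |f s|) (fun _ _ => abs_nonneg _)
      (Finset.mem_univ s)⟩

/-- Telescoping: everything beyond θ times elapsed time and the residuals is a boundary term,
bounded uniformly in T. -/
theorem sum_cost_orbit (ε θ : ℝ) (V : M.State → ℝ) (π : M.Policy) (s : M.State) (T : ℕ) :
    ∑ n ∈ Finset.range T, M.cost ((fun x => M.next x (π x))^[n] s)
        (π ((fun x => M.next x (π x))^[n] s)) =
      θ * ∑ n ∈ Finset.range T, (M.L (π ((fun x => M.next x (π x))^[n] s)) : ℝ) +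
      ∑ n ∈ Finset.range T, M.residual ε θ V ((fun x => M.next x (π x))^[n] s)
        (π ((fun x => M.next x (π x))^[n] s)) +
      (ε * V s - ε * V ((fun x => M.next x (π x))^[T] s)) := by
  induction T with
  | zero => simp
  | succ T ih =>
    simp only [Finset.sum_range_succ, ih, Function.iterate_succ_apply', residual]
    ring

theorem le_sum_L (σ : ℕ → Action) (T : ℕ) :
    (T : ℝ) ≤ ∑ n ∈ Finset.range T, (M.L (σ n) : ℝ) := by
  calc (T : ℝ) = ∑ _n ∈ Finset.range T, (1 : ℝ) := by simp
    _ ≤ _ := Finset.sum_le_sum fun n _ => by exact_mod_cast L_pos (σ n)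

open Filter Topology in
theorem le_avgCost (hps : M.ps = 1) {ε θ : ℝ} {V : M.State → ℝ}
    (hnn : ∀ s a, 0 ≤ M.residual ε θ V s a) (ρ : M.Policy) (s : M.State) :
    θ ≤ M.avgCost ρ s := by
  obtain ⟨K, hK0, hK⟩ := exists_forall_abs_le fun x => ε * V x
  obtain ⟨B, hB0, hB⟩ := exists_forall_abs_le fun x => M.cost x (ρ x)
  have hlim : Tendsto (fun T : ℕ => θ - 2 * K / (T : ℝ)) atTop (𝓝 θ) := by
    simpa using tendsto_const_nhds.sub (tendsto_const_div_atTop_nhds_zero_nat (2 * K))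
  rw [← hlim.limsup_eq, avgCost]
  simp only [expectAt_eq hps]
  refine limsup_le_limsup ?_ hlim.isCoboundedUnder_le ?_
  · filter_upwards [eventually_gt_atTop 0] with T hT
    have hT' : (0 : ℝ) < T := Nat.cast_pos.2 hT
    have hTL := le_sum_L (M := M) (fun n => ρ ((fun x => M.next x (ρ x))^[n] s)) T
    rw [sum_cost_orbit ε θ V]
    set S := ∑ n ∈ Finset.range T, (M.L (ρ ((fun x => M.next x (ρ x))^[n] s)) : ℝ)
    have hS : 0 < S := hT'.trans_le hTL
    have h1 := Finset.sum_nonneg fun n (_ : n ∈ Finset.range T) =>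
      hnn ((fun x => M.next x (ρ x))^[n] s) (ρ ((fun x => M.next x (ρ x))^[n] s))
    have h2 := abs_le.1 (hK s)
    have h3 := abs_le.1 (hK ((fun x => M.next x (ρ x))^[T] s))
    have h4 : 2 * K / S ≤ 2 * K / (T : ℝ) :=
      div_le_div_of_nonneg_left (by linarith) hT' hTL
    rw [le_div_iff₀ hS]
    have h5 : (θ - 2 * K / (T : ℝ)) * S ≤ (θ - 2 * K / S) * S :=
      mul_le_mul_of_nonneg_right (by linarith) hS.le
    have h6 : (θ - 2 * K / S) * S = θ * S - 2 * K := by field_simp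
    linarith [h2.1, h3.2]
  -- A real `limsup` is meaningful only for bounded quotients; each duration is at least 1, so a
  -- bound on the cost per step suffices.
  · refine isBoundedUnder_of ⟨B, fun T => ?_⟩
    have hTL := le_sum_L (M := M) (fun n => ρ ((fun x => M.next x (ρ x))^[n] s)) T
    refine div_le_of_le_mul₀ ((Nat.cast_nonneg T).trans hTL) hB0 ?_
    refine le_trans ?_ (mul_le_mul_of_nonneg_left hTL hB0)
    calc _ ≤ ∑ _n ∈ Finset.range T, B :=
          Finset.sum_le_sum fun n _ => (le_abs_self _).trans (hB _)
      _ = B * T := by simp [mul_comm]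

open Filter Topology in
theorem avgCost_eq (hps : M.ps = 1) {ε θ : ℝ} {V : M.State → ℝ} {π : M.Policy}
    (hz : ∀ s, M.residual ε θ V s (π s) = 0) (s : M.State) : M.avgCost π s = θ := by
  obtain ⟨K, hK0, hK⟩ := exists_forall_abs_le fun x => ε * V x
  refine Tendsto.limsup_eq ?_
  simp only [expectAt_eq hps]
  rw [tendsto_iff_norm_sub_tendsto_zero]
  refine squeeze_zero' (Eventually.of_forall fun _ => norm_nonneg _) ?_
    (tendsto_const_div_atTop_nhds_zero_nat (2 * K))
  filter_upwards [eventually_gt_atTop 0] with T hT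
  have hT' : (0 : ℝ) < T := Nat.cast_pos.2 hT
  have hTL := le_sum_L (M := M) (fun n => π ((fun x => M.next x (π x))^[n] s)) T
  rw [sum_cost_orbit ε θ V]
  set S := ∑ n ∈ Finset.range T, (M.L (π ((fun x => M.next x (π x))^[n] s)) : ℝ)
  have hS : 0 < S := hT'.trans_le hTL
  have h2 := abs_le.1 (hK s)
  have h3 := abs_le.1 (hK ((fun x => M.next x (π x))^[T] s))
  simp only [hz, Finset.sum_const_zero, add_zero]
  rw [add_div, mul_div_cancel_right₀ _ hS.ne', add_sub_cancel_left, Real.norm_eq_abs, abs_div,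
    abs_of_pos hS]
  refine div_le_div₀ (by linarith) (abs_le.2 ⟨?_, ?_⟩) hT' hTL
  · linarith [h2.1, h3.2]
  · linarith [h2.2, h3.1]

theorem isAverageOptimal_of_residual (hps : M.ps = 1) {ε θ : ℝ} {V : M.State → ℝ} {π : M.Policy}
    (hnn : ∀ s a, 0 ≤ M.residual ε θ V s a) (hz : ∀ s, M.residual ε θ V s (π s) = 0) :
    M.IsAverageOptimal π := fun ρ s => by
  rw [avgCost_eq hps hz]
  exact le_avgCost hps hnn ρ s

/-! ### Fast and slow updates -/

variable (M) in
/-- `fa` and `sa` are the two updating actions, `fa` being no longer than `sa`. -/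
structure FastSlow (fa sa : Action) : Prop where
  fast_ne_idle : fa ≠ .idle
  slow_ne_idle : sa ≠ .idle
  fast_ne_slow : fa ≠ sa
  L_fast : M.L fa = M.ageMin
  L_le : M.L fa ≤ M.L sa

theorem exists_fastSlow (hps : M.ps = 1) {af : Action} (haf : M.IsFastAction af) :
    ∃ sa, M.FastSlow af sa := by
  cases af with
  | idle => exact haf.elim
  | direct =>
    simp only [IsFastAction, hps, one_pow, div_one] at haf
    have h : M.Tu ≤ M.Tp + M.TuPre := by exact_mod_cast haf
    exact ⟨.preprocess, by simp, by simp, by simp, (min_eq_left h).symm, h⟩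
  | preprocess =>
    simp only [IsFastAction, hps, one_pow, div_one] at haf
    have h : M.Tp + M.TuPre ≤ M.Tu := by exact_mod_cast haf
    exact ⟨.direct, by simp, by simp, by simp, (min_eq_right h).symm, h⟩

namespace FastSlow

variable {fa sa : Action}

theorem action_cases (h : M.FastSlow fa sa) (a : Action) : a = .idle ∨ a = fa ∨ a = sa := by
  have h1 := h.fast_ne_idle
  have h2 := h.slow_ne_idle
  have h3 := h.fast_ne_slow
  cases fa <;> cases sa <;> cases a <;> simp_all

theorem ageMin_le_L (h : M.FastSlow fa sa) {a : Action} (ha : a ≠ .idle) : M.ageMin ≤ M.L a := by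
  rw [← h.L_fast]
  rcases h.action_cases a with rfl | rfl | rfl
  · exact absurd rfl ha
  · exact le_rfl
  · exact h.L_le

theorem one_le_ageMin (h : M.FastSlow fa sa) : 1 ≤ M.ageMin := h.L_fast ▸ L_pos fa

/-! ### Structure of Bellman-optimal policies -/

/-- Repeating the fast action bounds the optimal average cost. -/
theorem mul_theta_le (h : M.FastSlow fa sa) (hage : M.ageMin < M.ageMax) {ε θ : ℝ}
    {V : M.State → ℝ} (hnn : ∀ s a, 0 ≤ M.residual ε θ V s a) :
    θ * M.ageMin ≤ (M.ageMin : ℝ) * M.ageMin + ((M.ageMin : ℝ) * (M.ageMin - 1) / 2 +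
      M.omega * M.C fa) := by
  have hs : M.ageMin ∈ Finset.Icc 1 M.ageMax := Finset.mem_Icc.2 ⟨h.one_le_ageMin, hage.le⟩
  have hn : M.next ⟨M.ageMin, hs⟩ fa = ⟨M.ageMin, hs⟩ := by
    refine Subtype.ext ?_
    rw [next_update _ h.fast_ne_idle, h.L_fast]
    exact min_eq_left hage.le
  have h0 := hnn ⟨M.ageMin, hs⟩ fa
  rw [residual, hn, cost_eq, h.L_fast] at h0
  simp only at h0
  linarith

theorem theta_le (h : M.FastSlow fa sa) (hage : M.ageMin < M.ageMax) {ε θ : ℝ}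
    {V : M.State → ℝ} (hnn : ∀ s a, 0 ≤ M.residual ε θ V s a)
    (hcost : M.omega * M.C fa ≤ 1 / 2 * (M.ageMin : ℝ) * ((M.ageMin : ℝ) + 1)) :
    θ ≤ 2 * M.ageMin := by
  have hd : (0 : ℝ) < M.ageMin := Nat.cast_pos.2 h.one_le_ageMin
  refine le_of_mul_le_mul_right ?_ hd
  linarith [h.mul_theta_le hage hnn]

theorem theta_lt (h : M.FastSlow fa sa) (hage : M.ageMin < M.ageMax) {ε θ : ℝ}
    {V : M.State → ℝ} (hnn : ∀ s a, 0 ≤ M.residual ε θ V s a)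
    (hcost : M.omega * M.C fa < 1 / 2 * (M.ageMin : ℝ) * ((M.ageMin : ℝ) + 1)) :
    θ < 2 * M.ageMin := by
  have hd : (0 : ℝ) < M.ageMin := Nat.cast_pos.2 h.one_le_ageMin
  refine lt_of_mul_lt_mul_right ?_ hd.le
  linarith [h.mul_theta_le hage hnn]

theorem residual_idle_top {ε θ : ℝ} (V : M.State → ℝ) {s : M.State}
    (hs : (s : ℕ) = M.ageMax) : M.residual ε θ V s .idle = M.ageMax - θ := by
  have hn : M.next s .idle = s := Subtype.ext (by rw [next_idle, hs]; exact min_eq_right (by omega))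
  rw [residual_idle, hn, hs]
  ring

/-- Postponing an update by idling in state `s` saves at most `θ` and costs at least `s + L a`. -/
theorem residual_update_le (h : M.FastSlow fa sa) {ε θ : ℝ} {V : M.State → ℝ} {s t : M.State}
    (hs : M.ageMin ≤ (s : ℕ)) (ht : M.next s .idle = t) (hst : (t : ℕ) = s + 1)
    {a : Action} (ha : a ≠ .idle) (h0 : M.residual ε θ V t a = 0) :
    M.residual ε θ V s a ≤ M.residual ε θ V s .idle + (θ - 2 * M.ageMin) := by
  have h1 := residual_update_sub ε θ V s t ha
  have h2 := residual_idle ε θ V s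
  have h3 : (M.ageMin : ℝ) ≤ M.L a := by exact_mod_cast h.ageMin_le_L ha
  have h4 : (M.ageMin : ℝ) ≤ (s : ℕ) := by exact_mod_cast hs
  rw [ht] at h2
  rw [h0, hst] at h1
  push_cast at h1
  linarith

theorem next_idle_of_lt {s : M.State} (hs : (s : ℕ) < M.ageMax) :
    (M.next s .idle : ℕ) = s + 1 := by
  rw [next_idle]
  exact min_eq_left hs

/-- Downward induction from the age cap, where idling has residual `ageMax` - θ > 0. Below it, if
idling is optimal in s, the update optimal in s + 1 is already optimal in s. -/
theorem exists_update_residual_eq_zero (h : M.FastSlow fa sa)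
    (hage : 2 * M.ageMin < M.ageMax) {ε θ : ℝ} {V : M.State → ℝ} (hθ : θ ≤ 2 * M.ageMin)
    (hnn : ∀ s a, 0 ≤ M.residual ε θ V s a) (hz : ∀ s, ∃ a, M.residual ε θ V s a = 0)
    (s : M.State) (hs : M.ageMin ≤ (s : ℕ)) :
    ∃ a, a ≠ .idle ∧ M.residual ε θ V s a = 0 := by
  obtain ⟨k, hk⟩ := Nat.exists_eq_add_of_le (state_le s)
  induction k generalizing s with
  | zero =>
    obtain ⟨a, ha⟩ := hz s
    refine ⟨a, ?_, ha⟩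
    rintro rfl
    rw [residual_idle_top V (by omega)] at ha
    have : (2 * M.ageMin : ℝ) < M.ageMax := by exact_mod_cast hage
    linarith
  | succ k ih =>
    obtain ⟨a, ha⟩ := hz s
    by_cases hi : a = .idle
    · subst hi
      have hn : (M.next s .idle : ℕ) = s + 1 := next_idle_of_lt (by omega)
      obtain ⟨b, hb, hb0⟩ := ih (M.next s .idle) (by omega) (by omega)
      have h1 := h.residual_update_le hs rfl hn hb hb0
      exact ⟨b, hb, le_antisymm (by linarith) (hnn s b)⟩
    · exact ⟨a, hi, ha⟩

theorem residual_idle_pos (h : M.FastSlow fa sa)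
    (hage : 2 * M.ageMin < M.ageMax) {ε θ : ℝ} {V : M.State → ℝ} (hθ : θ < 2 * M.ageMin)
    (hnn : ∀ s a, 0 ≤ M.residual ε θ V s a) (hz : ∀ s, ∃ a, M.residual ε θ V s a = 0)
    (s : M.State) (hs : M.ageMin ≤ (s : ℕ)) : 0 < M.residual ε θ V s .idle := by
  rcases (state_le s).eq_or_lt with htop | hlt
  · rw [residual_idle_top V htop]
    have : (2 * M.ageMin : ℝ) < M.ageMax := by exact_mod_cast hage
    linarith
  · have hn : (M.next s .idle : ℕ) = s + 1 := next_idle_of_lt hlt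
    obtain ⟨b, hb, hb0⟩ :=
      h.exists_update_residual_eq_zero hage hθ.le hnn hz (M.next s .idle) (by omega)
    have h1 := h.residual_update_le hs rfl hn hb hb0
    linarith [hnn s b]

/-- The advantage of the slow over the fast action is affine in the age. -/
theorem residual_sub (h : M.FastSlow fa sa) (ε θ : ℝ) (V : M.State → ℝ) (s t : M.State) :
    M.residual ε θ V t fa - M.residual ε θ V t sa =
      M.residual ε θ V s fa - M.residual ε θ V s sa -
        ((M.L sa : ℝ) - M.L fa) * (((t : ℕ) : ℝ) - ((s : ℕ) : ℝ)) := by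
  linarith [residual_update_sub ε θ V s t h.fast_ne_idle,
    residual_update_sub ε θ V s t h.slow_ne_idle]

end FastSlow

/-! ### Switch-type policies -/

theorem exists_isThreshold (hage : M.ageMin ≤ M.ageMax) {π : M.Policy} {lo hi : Action}
    (hcases : ∀ s : M.State, M.ageMin ≤ (s : ℕ) → π s = lo ∨ π s = hi)
    (hmono : ∀ s t : M.State, M.ageMin ≤ (s : ℕ) → (s : ℕ) ≤ t → π s = hi → π t = hi) :
    ∃ Ω, M.ageMin ≤ Ω ∧ M.IsThreshold π lo hi Ω := by
  classical
  by_cases hex : ∃ n, M.ageMin ≤ n ∧ ∃ s : M.State, (s : ℕ) = n ∧ π s = hi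
  · obtain ⟨hle, s₀, hs₀, hπ⟩ := Nat.find_spec hex
    refine ⟨Nat.find hex, hle, fun s hs => ⟨fun hlt => ?_, fun hge => ?_⟩⟩
    · exact (hcases s hs).resolve_right fun hhi => Nat.find_min hex hlt ⟨hs, s, rfl, hhi⟩
    · exact hmono s₀ s (hs₀ ▸ hle) (hs₀ ▸ hge) hπ
  · refine ⟨M.ageMax + 1, by omega, fun s hs => ⟨fun _ => ?_, fun hge => ?_⟩⟩
    · exact (hcases s hs).resolve_right fun hhi => hex ⟨s, hs, s, rfl, hhi⟩
    -- When `hi` is never taken, the threshold `ageMax + 1` lies beyond every state.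
    · exact absurd (state_le s) (by omega)

namespace FastSlow

variable {fa sa : Action}

/-- For updates of equal length both clauses of the switch property apply, so monotonicity is then
needed in both directions. -/
theorem isSwitchType (h : M.FastSlow fa sa) (hage : M.ageMin ≤ M.ageMax) {π : M.Policy}
    (hidle : ∀ s : M.State, M.ageMin ≤ (s : ℕ) → π s ≠ .idle)
    (hfast : ∀ s t : M.State, M.ageMin ≤ (s : ℕ) → (s : ℕ) ≤ t → π s = fa → π t = fa)
    (hslow : M.L fa = M.L sa →
      ∀ s t : M.State, M.ageMin ≤ (s : ℕ) → (s : ℕ) ≤ t → π s = sa → π t = sa) :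
    M.IsSwitchType π := by
  have hc : ∀ s : M.State, M.ageMin ≤ (s : ℕ) → π s = sa ∨ π s = fa := fun s hs =>
    ((h.action_cases (π s)).resolve_left (hidle s hs)).symm
  have h1 := exists_isThreshold hage hc hfast
  have h2 := fun e : M.L fa = M.L sa =>
    exists_isThreshold hage (fun s hs => (hc s hs).symm) (hslow e)
  refine ⟨hidle, ?_⟩
  obtain ⟨hf, hs, hne, -, hle⟩ := h
  match fa, sa with
  | .idle, _ => exact absurd rfl hf
  | _, .idle => exact absurd rfl hs
  | .direct, .direct => exact absurd rfl hne
  | .preprocess, .preprocess => exact absurd rfl hne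
  | .direct, .preprocess => exact ⟨fun _ => h1, fun e => h2 (le_antisymm hle e)⟩
  | .preprocess, .direct => exact ⟨fun e => h2 (le_antisymm hle e), fun _ => h1⟩

/-- Every state leads to one common state, hence there is a single recurrent class. -/
theorem isUnichain (h : M.FastSlow fa sa) (hps : M.ps = 1) (hage : M.ageMin < M.ageMax)
    {π : M.Policy}
    (hidle : ∀ s : M.State, M.ageMin ≤ (s : ℕ) → π s ≠ .idle)
    (hfast : ∀ s t : M.State, M.ageMin ≤ (s : ℕ) → (s : ℕ) ≤ t → π s = fa → π t = fa) :
    M.IsUnichain π := by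
  have hstep : ∀ s, M.Accessible π s (M.next s (π s)) := fun s =>
    Relation.ReflTransGen.single (by rw [trans_eq hps, if_pos rfl]; exact one_pos)
  let d : M.State := ⟨M.ageMin, Finset.mem_Icc.2 ⟨h.one_le_ageMin, hage.le⟩⟩
  have hupd : ∀ (s : M.State) (a : Action), a ≠ .idle → M.ageMin ≤ (M.next s a : ℕ) := by
    intro s a ha
    rw [next_update s ha]
    exact le_min (h.ageMin_le_L ha) hage.le
  -- From lower ages, idling climbs one step and any update lands at `ageMin` or above.
  suffices ∃ z, ∀ s : M.State, M.ageMin ≤ (s : ℕ) → M.Accessible π s z by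
    obtain ⟨z, hz⟩ := this
    have hall : ∀ s, M.Accessible π s z := by
      intro s
      obtain hs | hs := le_total M.ageMin (s : ℕ)
      · exact hz s hs
      · obtain ⟨k, hk⟩ := Nat.exists_eq_add_of_le hs
        induction k generalizing s with
        | zero => exact hz s (by omega)
        | succ k ih =>
          refine (hstep s).trans ?_
          by_cases hi : π s = .idle
          · have hn : (M.next s (π s) : ℕ) = s + 1 := by
              rw [hi]; exact next_idle_of_lt (by omega)
            exact ih _ (by omega) (by omega)
          · exact hz _ (hupd s _ hi)
    intro s t _ ht
    exact (hall s).trans (ht z (hall t))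
  have hd : M.next d fa = d := by
    refine Subtype.ext ?_
    rw [next_update _ h.fast_ne_idle, h.L_fast]
    exact min_eq_left hage.le
  -- If the fast action is taken at d, monotonicity forces it at all higher ages and all lead to d.
  -- Otherwise the common state is the landing point of the slow action, reached directly or through
  -- d.
  rcases (h.action_cases (π d)).resolve_left (hidle d le_rfl) with hf | hsl
  · refine ⟨d, fun s hs => ?_⟩
    have h1 := hstep s
    rwa [hfast d s le_rfl hs hf, next_update_eq s d h.fast_ne_idle, hd] at h1
  · refine ⟨M.next d sa, fun s hs => ?_⟩
    have h2 := hstep d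
    rw [hsl] at h2
    have h1 := hstep s
    rcases (h.action_cases (π s)).resolve_left (hidle s hs) with hf' | hsl'
    · rw [hf', next_update_eq s d h.fast_ne_idle, hd] at h1
      exact h1.trans h2
    · rwa [hsl', next_update_eq s d h.slow_ne_idle] at h1

theorem isSwitchType_of_residual (h : M.FastSlow fa sa) (hage : 2 * M.ageMin < M.ageMax)
    {ε θ : ℝ} {V : M.State → ℝ} (hθ : θ < 2 * M.ageMin) (hlt : M.L fa < M.L sa)
    (hnn : ∀ s a, 0 ≤ M.residual ε θ V s a) {π : M.Policy}
    (hz : ∀ s, M.residual ε θ V s (π s) = 0) : M.IsSwitchType π := by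
  have hidle : ∀ s : M.State, M.ageMin ≤ (s : ℕ) → π s ≠ .idle := by
    intro s hs hi
    have h1 := h.residual_idle_pos hage hθ hnn (fun s => ⟨_, hz s⟩) s hs
    rw [← hi, hz s] at h1
    exact lt_irrefl _ h1
  refine h.isSwitchType (by omega) hidle (fun s t hs hst hf => ?_) fun e => absurd e hlt.ne
  rcases hst.eq_or_lt with heq | hst'
  · rwa [← Subtype.ext heq]
  refine ((h.action_cases (π t)).resolve_left (hidle t (hs.trans hst))).resolve_right fun hsl => ?_
  have h1 := h.residual_sub ε θ V s t
  have h2 := hz s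
  have h3 := hz t
  rw [hf] at h2
  rw [hsl] at h3
  rw [h2, h3] at h1
  have h4 : (0 : ℝ) < ((M.L sa : ℝ) - M.L fa) * (((t : ℕ) : ℝ) - ((s : ℕ) : ℝ)) :=
    mul_pos (sub_pos.2 (Nat.cast_lt.2 hlt)) (sub_pos.2 (Nat.cast_lt.2 hst'))
  -- Fast at s and slow at t > s would make the nonnegative residual of the fast action at t
  -- strictly negative; no tie-breaking is needed.
  linarith [hnn t fa, hnn s sa]

-- Ties at ages ≥ `ageMin` are broken in favour of the fast action, so the ages at which it is used
-- form an up-set. For equal lengths the residual difference is constant, so the choice is the same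
-- at all these ages.
open Classical in
theorem exists_switchType_policy (h : M.FastSlow fa sa) (hps : M.ps = 1)
    (hage : 2 * M.ageMin < M.ageMax) {ε θ : ℝ} {V : M.State → ℝ} (hθ : θ ≤ 2 * M.ageMin)
    (hnn : ∀ s a, 0 ≤ M.residual ε θ V s a) (hz : ∀ s, ∃ a, M.residual ε θ V s a = 0) :
    ∃ π : M.Policy, (∀ s, M.residual ε θ V s (π s) = 0) ∧ M.IsUnichain π ∧ M.IsSwitchType π := by
  have hupd : ∀ s : M.State, M.ageMin ≤ (s : ℕ) →
      M.residual ε θ V s fa = 0 ∨ M.residual ε θ V s sa = 0 := by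
    intro s hs
    obtain ⟨a, ha, ha0⟩ := h.exists_update_residual_eq_zero hage hθ hnn hz s hs
    rcases (h.action_cases a).resolve_left ha with rfl | rfl
    · exact .inl ha0
    · exact .inr ha0
  choose α hα using hz
  let π : M.Policy := fun s =>
    if M.ageMin ≤ (s : ℕ) then if M.residual ε θ V s fa = 0 then fa else sa else α s
  have hπf : ∀ s : M.State, M.ageMin ≤ (s : ℕ) → (π s = fa ↔ M.residual ε θ V s fa = 0) := by
    intro s hs
    simp only [π, if_pos hs]
    split_ifs with h0
    · simp [h0]
    · simp [h0, h.fast_ne_slow.symm]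
  have hπs : ∀ s : M.State, M.ageMin ≤ (s : ℕ) → (π s = sa ↔ M.residual ε θ V s fa ≠ 0) := by
    intro s hs
    simp only [π, if_pos hs]
    split_ifs with h0
    · simp [h0, h.fast_ne_slow]
    · simp [h0]
  have hπ0 : ∀ s, M.residual ε θ V s (π s) = 0 := by
    intro s
    by_cases hs : M.ageMin ≤ (s : ℕ)
    · by_cases h0 : M.residual ε θ V s fa = 0
      · rwa [(hπf s hs).2 h0]
      · rw [(hπs s hs).2 h0]
        exact (hupd s hs).resolve_left h0
    · simp only [π, if_neg hs]
      exact hα s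
  have hidle : ∀ s : M.State, M.ageMin ≤ (s : ℕ) → π s ≠ .idle := by
    intro s hs
    by_cases h0 : M.residual ε θ V s fa = 0
    · rw [(hπf s hs).2 h0]; exact h.fast_ne_idle
    · rw [(hπs s hs).2 h0]; exact h.slow_ne_idle
  have hfast : ∀ s t : M.State, M.ageMin ≤ (s : ℕ) → (s : ℕ) ≤ t → π s = fa → π t = fa := by
    intro s t hs hst hf
    rw [hπf s hs] at hf
    rw [hπf t (hs.trans hst)]
    rcases hupd t (hs.trans hst) with h0 | h0
    · exact h0
    · have h1 := h.residual_sub ε θ V s t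
      have h2 : (0 : ℝ) ≤ ((M.L sa : ℝ) - M.L fa) * (((t : ℕ) : ℝ) - ((s : ℕ) : ℝ)) :=
        mul_nonneg (sub_nonneg.2 (Nat.cast_le.2 h.L_le)) (sub_nonneg.2 (Nat.cast_le.2 hst))
      exact le_antisymm (by linarith [hnn s sa]) (hnn t fa)
  refine ⟨π, hπ0, h.isUnichain hps (by omega) hidle hfast,
    h.isSwitchType (by omega) hidle hfast fun e s t hs hst hsl => ?_⟩
  have hr := hπ0 s
  rw [hsl] at hr
  rw [hπs s hs] at hsl
  rw [hπs t (hs.trans hst)]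
  intro h0
  have h1 := h.residual_sub ε θ V s t
  rw [e, sub_self, zero_mul, hr, h0] at h1
  exact hsl (le_antisymm (by linarith [hnn t sa]) (hnn s fa))

/-! ### Existence of a solution -/

/-- The Bellman equation restricted to the two ages reached by updates. -/
theorem exists_cycle_solution {d l : ℝ} (hd : 0 < d) (hl : 0 < l) (m kf ks : ℝ) :
    ∃ θ y : ℝ, min (d * d + kf - θ * d) (l * d + ks - θ * l + y) = 0 ∧
      min (d * m + kf - θ * d) (l * m + ks - θ * l + y) = y := by
  -- The mean costs of the three possible cycles: fast forever at d, slow from d alternating with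
  -- fast from m, slow forever at m. The least of them is θ, and the other two comparisons are the
  -- remaining inequalities.
  let θ₁ := (d * d + kf) / d
  let θ₂ := (l * d + ks + d * m + kf) / (l + d)
  let θ₃ := (l * m + ks) / l
  have e₁ : θ₁ * d = d * d + kf := div_mul_cancel₀ _ hd.ne'
  have e₂ : θ₂ * (l + d) = l * d + ks + d * m + kf := div_mul_cancel₀ _ (by positivity)
  have e₃ : θ₃ * l = l * m + ks := div_mul_cancel₀ _ hl.ne'
  obtain ⟨θ, h₁, h₂, h₃, hθ⟩ : ∃ θ, θ ≤ θ₁ ∧ θ ≤ θ₂ ∧ θ ≤ θ₃ ∧ (θ = θ₁ ∨ θ = θ₂ ∨ θ = θ₃) := by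
    refine ⟨min θ₁ (min θ₂ θ₃), min_le_left _ _, (min_le_right _ _).trans (min_le_left _ _),
      (min_le_right _ _).trans (min_le_right _ _), ?_⟩
    rcases min_choice θ₁ (min θ₂ θ₃) with e | e
    · exact .inl e
    · rw [e]; exact .inr (min_choice _ _)
  have g₁ := mul_le_mul_of_nonneg_right h₁ hd.le
  have g₂ := mul_le_mul_of_nonneg_right h₂ (add_pos hl hd).le
  have g₃ := mul_le_mul_of_nonneg_right h₃ hl.le
  rcases hθ with rfl | rfl | rfl
  · refine ⟨θ₁, d * m + kf - θ₁ * d, ?_, ?_⟩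
    · rw [min_eq_left] <;> linarith
    · rw [min_eq_left]; linarith
  · refine ⟨θ₂, d * m + kf - θ₂ * d, ?_, ?_⟩
    · rw [min_eq_right] <;> linarith
    · rw [min_eq_left]; linarith
  · refine ⟨θ₃, -(l * d + ks - θ₃ * l), ?_, ?_⟩
    · rw [min_eq_right] <;> linarith
    · rw [min_eq_right] <;> linarith

theorem exists_backward_recursion (G c : ℕ → ℝ) (d : ℕ) :
    ∃ W : ℕ → ℝ, (∀ s, d ≤ s → W s = G s) ∧ ∀ s, s < d → W s = min (G s) (c s + W (s + 1)) := by
  -- `g k` is the value at d - k.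
  let g : ℕ → ℝ := fun k => Nat.rec (G d)
    (fun k x => min (G (d - (k + 1))) (c (d - (k + 1)) + x)) k
  refine ⟨fun s => if d ≤ s then G s else g (d - s), fun s hs => if_pos hs, fun s hs => ?_⟩
  obtain ⟨k, rfl⟩ : ∃ k, d = s + k + 1 := ⟨d - s - 1, by omega⟩
  have e : s + k + 1 - s = k + 1 := by omega
  have e' : s + k + 1 - (k + 1) = s := by omega
  have hg : g (k + 1) = min (G s) (c s + g k) := by
    change min (G (s + k + 1 - (k + 1))) (c (s + k + 1 - (k + 1)) + g k) = _
    rw [e']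
  simp only [if_neg (not_le.2 hs), e, hg]
  congr 2
  split_ifs with hk
  · obtain rfl : k = 0 := by omega
    rfl
  · congr 1
    omega

/-- The candidate is V = W/ε with W = 0 at `ageMin` and W = y at the landing age of the slow action.
Idling enters W only below `ageMin`; above, it must be checked to bring no gain. -/
theorem exists_bellman (h : M.FastSlow fa sa) (hps : M.ps = 1) {ε : ℝ} (hε : 0 < ε)
    (hage : 2 * M.ageMin < M.ageMax)
    (hcost : M.omega * M.C fa ≤ 1 / 2 * (M.ageMin : ℝ) * ((M.ageMin : ℝ) + 1)) :
    ∃ θ V, M.Bellman ε θ V := by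
  obtain ⟨kf, hkf⟩ : ∃ kf, kf = (M.ageMin : ℝ) * (M.ageMin - 1) / 2 + M.omega * M.C fa := ⟨_, rfl⟩
  obtain ⟨ks, hks⟩ : ∃ ks, ks = (M.L sa : ℝ) * (M.L sa - 1) / 2 + M.omega * M.C sa := ⟨_, rfl⟩
  have hd : (0 : ℝ) < M.ageMin := Nat.cast_pos.2 h.one_le_ageMin
  have hdl : (M.ageMin : ℝ) ≤ M.L sa := by
    rw [← h.L_fast]; exact_mod_cast h.L_le
  obtain ⟨θ, y, hGd, hGm⟩ :=
    exists_cycle_solution hd (L_pos_real sa) (min (M.L sa) M.ageMax : ℕ) kf ks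
  obtain ⟨W, hW, hW'⟩ := exists_backward_recursion
    (fun s => min ((M.ageMin : ℝ) * s + kf - θ * M.ageMin) (M.L sa * s + ks - θ * M.L sa + y))
    (fun s => (s : ℝ) - θ) M.ageMin
  -- The bound of `theta_le`, obtained before a Bellman solution is available: the first cycle
  -- equation makes the fast branch at `ageMin` nonnegative.
  have hθ : θ ≤ 2 * M.ageMin := by
    have h1 := min_le_left ((M.ageMin : ℝ) * M.ageMin + kf - θ * M.ageMin)
      (M.L sa * M.ageMin + ks - θ * M.L sa + y)
    refine le_of_mul_le_mul_right ?_ hd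
    linarith
  have hWd : W M.ageMin = 0 := (hW _ le_rfl).trans hGd
  have hWm : W (min (M.L sa) M.ageMax) = y := by
    refine (hW _ (le_min (h.ageMin_le_L h.slow_ne_idle) (by omega))).trans hGm
  have hf : ∀ s : M.State, M.residual ε θ (fun s => W s / ε) s fa =
      (M.ageMin : ℝ) * (s : ℕ) + kf - θ * M.ageMin - W s := by
    intro s
    rw [residual, next_update s h.fast_ne_idle, cost_eq, mul_div_cancel₀ _ hε.ne',
      mul_div_cancel₀ _ hε.ne', h.L_fast, min_eq_left (by omega : M.ageMin ≤ M.ageMax), hWd, hkf]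
    ring
  have hs : ∀ s : M.State, M.residual ε θ (fun s => W s / ε) s sa =
      (M.L sa : ℝ) * (s : ℕ) + ks - θ * M.L sa + y - W s := by
    intro s
    rw [residual, next_update s h.slow_ne_idle, cost_eq, mul_div_cancel₀ _ hε.ne',
      mul_div_cancel₀ _ hε.ne', hWm, hks]
  have hi : ∀ s : M.State, M.residual ε θ (fun s => W s / ε) s .idle =
      (s : ℕ) - θ + W (min ((s : ℕ) + 1) M.ageMax) - W s := by
    intro s
    rw [residual_idle, next_idle, mul_div_cancel₀ _ hε.ne', mul_div_cancel₀ _ hε.ne']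
  refine ⟨θ, fun s => W s / ε, (bellman_iff hps).2 fun s => ?_⟩
  suffices hmin : (W s ≤ (M.ageMin : ℝ) * (s : ℕ) + kf - θ * M.ageMin ∧
      W s ≤ M.L sa * (s : ℕ) + ks - θ * M.L sa + y ∧
      W s ≤ (s : ℕ) - θ + W (min ((s : ℕ) + 1) M.ageMax)) ∧
      (W s = (M.ageMin : ℝ) * (s : ℕ) + kf - θ * M.ageMin ∨
        W s = M.L sa * (s : ℕ) + ks - θ * M.L sa + y ∨
        W s = (s : ℕ) - θ + W (min ((s : ℕ) + 1) M.ageMax)) by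
    obtain ⟨⟨h1, h2, h3⟩, h4⟩ := hmin
    constructor
    · intro a
      rcases h.action_cases a with rfl | rfl | rfl
      · rw [hi]; linarith
      · rw [hf]; linarith
      · rw [hs]; linarith
    · rcases h4 with h4 | h4 | h4
      · exact ⟨fa, by rw [hf]; linarith⟩
      · exact ⟨sa, by rw [hs]; linarith⟩
      · exact ⟨.idle, by rw [hi]; linarith⟩
  rcases lt_or_ge (s : ℕ) M.ageMin with hlt | hge
  · have hmin : min ((s : ℕ) + 1) M.ageMax = s + 1 := min_eq_left (by omega)
    rw [hmin, hW' s hlt]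
    refine ⟨⟨(min_le_left _ _).trans (min_le_left _ _), (min_le_left _ _).trans (min_le_right _ _),
      min_le_right _ _⟩, ?_⟩
    rcases min_choice (min ((M.ageMin : ℝ) * (s : ℕ) + kf - θ * M.ageMin)
      (M.L sa * (s : ℕ) + ks - θ * M.L sa + y)) ((s : ℕ) - θ + W (s + 1)) with e | e
    · rw [e]
      exact (min_choice _ _).imp_right .inl
    · exact .inr (.inr e)
  · refine ⟨⟨?_, ?_, ?_⟩, ?_⟩
    · rw [hW s hge]; exact min_le_left _ _
    · rw [hW s hge]; exact min_le_right _ _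
    · rcases (state_le s).eq_or_lt with htop | htop
      · have hmin : min ((s : ℕ) + 1) M.ageMax = s := by omega
        have : (2 * M.ageMin : ℝ) < (s : ℕ) := by rw [htop]; exact_mod_cast hage
        rw [hmin]
        linarith
      · have hmin : min ((s : ℕ) + 1) M.ageMax = s + 1 := min_eq_left (by omega)
        have hge' : (M.ageMin : ℝ) ≤ (s : ℕ) := by exact_mod_cast hge
        rw [hmin, hW s hge, hW (s + 1) (by omega), ← sub_le_iff_le_add']
        push_cast
        -- Each branch grows by its update length, at least `ageMin`, from s to s + 1; with s ≥
        -- `ageMin` this outweighs θ.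
        refine le_min ?_ ?_
        · refine (sub_le_sub_right (min_le_left _ _) _).trans ?_
          linarith
        · refine (sub_le_sub_right (min_le_right _ _) _).trans ?_
          linarith
    · rw [hW s hge]
      exact (min_choice _ _).imp_right .inl

end FastSlow

end Model

end StatusUpdate

theorem theorem2 (M : StatusUpdate.Model) (hps : M.ps = 1)
    (ε : ℝ) (hε : 0 < ε) (hεL : ∀ a, ε ≤ (M.L a : ℝ))
    (af : StatusUpdate.Action) (haf : M.IsFastAction af)
    (hage : 2 * M.L af < M.ageMax)
    (hcost : M.omega * M.C af ≤ 1 / 2 * (M.L af : ℝ) * ((M.L af : ℝ) + 1)) :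
    (∃ θ V, M.Bellman ε θ V) ∧
    ∀ θ V, M.Bellman ε θ V →
      (∃ π : M.Policy, M.IsBellmanOptimal ε V π ∧ M.IsAverageOptimal π ∧ M.IsUnichain π ∧
        M.IsSwitchType π) ∧
      (M.omega * M.C af < 1 / 2 * (M.L af : ℝ) * ((M.L af : ℝ) + 1) →
        M.Tu ≠ M.Tp + M.TuPre →
        ∀ π : M.Policy, M.IsBellmanOptimal ε V π → M.IsSwitchType π) := by
  obtain ⟨sa, h⟩ := StatusUpdate.Model.exists_fastSlow hps haf
  rw [h.L_fast] at hage hcost ⊢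
  refine ⟨h.exists_bellman hps hε hage hcost, fun θ V hB => ?_⟩
  have hres := (StatusUpdate.Model.bellman_iff hps).1 hB
  have hnn := fun s => (hres s).1
  have hz := fun s => (hres s).2
  constructor
  · obtain ⟨π, hπ, hu, hsw⟩ :=
      h.exists_switchType_policy hps hage (h.theta_le (by omega) hnn hcost) hnn hz
    exact ⟨π, (StatusUpdate.Model.isBellmanOptimal_iff hps hB).2 hπ,
      StatusUpdate.Model.isAverageOptimal_of_residual hps hnn hπ, hu, hsw⟩
  · intro hlt hne π hπ
    refine h.isSwitchType_of_residual hage (h.theta_lt (by omega) hnn hlt)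
      (lt_of_le_of_ne h.L_le fun e => hne ?_) hnn
      ((StatusUpdate.Model.isBellmanOptimal_iff hps hB).1 hπ)
    rcases h.action_cases .direct with e1 | e1 | e1 <;>
      rcases h.action_cases .preprocess with e2 | e2 | e2 <;>
      first
        | exact absurd e1 (by simp)
        | exact absurd e2 (by simp)
        | (rw [← e1] at e2; exact absurd e2 (by simp))
        | (rw [← e1, ← e2] at e; first | exact e | exact e.symm)
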